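/- Conventions. Let $n\ge 1$. A cube is a set $Q=\{a\}+(-\delta,\delta]^n\subset\mathbb{R}^n$ ($a\in\mathbb{R}^n$, $\delta>0$); its sidelength is $\delta_Q=2\delta$, and for $A>0$, $AQ$ is the cube with the same center and sidelength $A\delta_Q$. A cube is dyadic if it has the form $\prod_{i=1}^n (j_i2^k,(j_i+1)2^k]$ with $j_1,\dots,j_n,k\in\mathbb{Z}$. Let $c_G>0$. There are constants $C>0$ and $0<c<1$, depending only on $n$ and $c_G$ (so only on $n$, if $c_G$ is a fixed constant determined by $n$), such that the following holds. Let $CZ$ be a partition of $\mathbb{R}^n$ into dyadic cubes such that for all $Q,Q'\in CZ$, $$(1+10c_G)Q\cap(1+10c_G)Q'\ne\emptyset \implies \tfrac1{64}\delta_Q\le\delta_{Q'}\le 64\,\delta_Q ,$$ and let $E\subset\mathbb{R}^n$ be a finite set with $N=\#(E)\ge 2$ and $\#(E\cap 9Q)\ge 2$ for every $Q\in CZ$. Call $Q\in CZ$ a keystone cube if $\delta_{Q'}\ge\delta_Q$ for every $Q'\in CZ$ with $Q'\cap 100Q\neq\emptyset$. Then there are a subset $CZ_{\rm special}\subset CZ$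 and an assignment to each $Q\in CZ$ of a finite sequence $\mathcal S_Q=(Q_1,\dots,Q_L)$ of cubes of $CZ$ (with $L\ge1$ depending on $Q$) such that: (i) $CZ_{\rm special}$ contains at most $C\cdot N$ distinct cubes. (ii) For each $Q\in CZ$: $Q_1=Q$; $Q_L$ is a keystone cube; $(1+c_G)Q_l\cap(1+c_G)Q_{l+1}\ne\emptyset$ for $1\le l<L$; and $\delta_{Q_k}\le C(1-c)^{k-l}\delta_{Q_l}$ for $1\le l\le k\le L$. (iii) If $Q,Q'\in CZ\setminus CZ_{\rm special}$ satisfy $(1+c_G)Q\cap(1+c_G)Q'\neq\emptyset$, and $\mathcal S_Q=(Q_1,\dots,Q_L)$, $\mathcal S_{Q'}=(Q'_1,\dots,Q'_{L'})$, then $Q_L=Q'_{L'}$. -/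

import Mathlib

/-- A cube `{a} + (-δ, δ]ⁿ` in `ℝⁿ`, with center `a` and half-side `δ > 0`. -/
structure AxisCube (n : ℕ) where
  center : Fin n → ℝ
  halfSide : ℝ
  halfSide_pos : 0 < halfSide

namespace AxisCube

variable {n : ℕ}

/-- The sidelength `δ_Q`. -/
noncomputable def side (Q : AxisCube n) : ℝ := 2 * Q.halfSide

/-- The set of points of the cube `A Q` (same center as `Q`, sidelength `A * δ_Q`), for `A > 0`. -/
def dilate (A : ℝ) (Q : AxisCube n) : Set (Fin n → ℝ) :=
  Set.pi Set.univ fun i => Set.Ioc (Q.center i - A * Q.halfSide) (Q.center i + A * Q.halfSide)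

/-- The set of points of the cube `Q`. -/
def toSet (Q : AxisCube n) : Set (Fin n → ℝ) :=
  Set.pi Set.univ fun i => Set.Ioc (Q.center i - Q.halfSide) (Q.center i + Q.halfSide)

/-- `Q` is a product of intervals `(j_i 2^k, (j_i + 1) 2^k]` with `j_i, k ∈ ℤ`. -/
def IsDyadic (Q : AxisCube n) : Prop :=
  ∃ (k : ℤ) (j : Fin n → ℤ), Q.toSet =
    Set.pi Set.univ fun i => Set.Ioc ((j i : ℝ) * (2 : ℝ) ^ k) (((j i : ℝ) + 1) * (2 : ℝ) ^ k)

end AxisCube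

/-- A CZ decomposition of `ℝⁿ`: a partition of `ℝⁿ` into dyadic cubes that has good geometry
with constant `cG`. -/
structure IsCZDecomposition {n : ℕ} (cG : ℝ) (CZ : Set (AxisCube n)) : Prop where
  dyadic : ∀ Q ∈ CZ, Q.IsDyadic
  cover : ⋃ Q ∈ CZ, Q.toSet = Set.univ
  disjoint : CZ.PairwiseDisjoint AxisCube.toSet
  goodGeometry : ∀ Q ∈ CZ, ∀ Q' ∈ CZ,
    (Q.dilate (1 + 10 * cG) ∩ Q'.dilate (1 + 10 * cG)).Nonempty →
      (1 / 64 : ℝ) * Q.side ≤ Q'.side ∧ Q'.side ≤ 64 * Q.side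

/-- `Q ∈ CZ` is keystone if every cube of `CZ` that meets `100 Q` is at least as large as `Q`. -/
def IsKeystone {n : ℕ} (CZ : Set (AxisCube n)) (Q : AxisCube n) : Prop :=
  Q ∈ CZ ∧ ∀ Q' ∈ CZ, (Q'.toSet ∩ Q.dilate 100).Nonempty → Q.side ≤ Q'.side

/-!
A sequence of neighboring cubes is read off from a chain of points that moves by a small multiple
of `δ`, the side of the cube at the current point. Each state of the chain also carries a potential
comparable to `δ`. Every step shrinks the potential by at least the factor `θ = 1 - c`, so geometric
decay survives concatenation, and since `θ ^ M ≥ 1 / 2`, halving it pays for `M` steps. From a cube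
that is not keystone, walk along a segment towards a smaller cube meeting its `100`-fold
dilate until the side drops. By dyadicity it has at least halved. Sides are bounded below, so this
ends in a keystone cube.

The cubes that are not special are those that see the part of `E` near them as a tiny cluster
around a point `p`. Outside a small ball around `p` the sides are comparable to the distance from
`p`, because each `9Q` meets `E`. So one may walk radially towards `p`, then around `p` to a target
determined by the cluster and, in dimension one, by the side of `p` on which the walk takes place,
and only then descend to a keystone cube. Touching nonspecial cubes have the same target.

Each special cube has side comparable either to the side of the cube at some `e ∈ E`, or to the
distance from `e` to its predecessors in a farthest-first enumeration of `E`, and lies close to `e`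
on that scale. Disjointness bounds the number of cubes charged to each `e`.
-/

open Relation

/-- The numbers `a` and `b`, thought of as positive, are comparable up to the factor `K`. -/
def WithinFactor (K a b : ℝ) : Prop := a ≤ K * b ∧ b ≤ K * a

theorem WithinFactor.of_one_le {K a : ℝ} (hK : 1 ≤ K) (ha : 0 ≤ a) : WithinFactor K a a :=
  ⟨le_mul_of_one_le_left ha hK, le_mul_of_one_le_left ha hK⟩

theorem WithinFactor.trans {K L a b c : ℝ} (hK : 0 ≤ K) (hL : 0 ≤ L) (hab : WithinFactor K a b)
    (hbc : WithinFactor L b c) : WithinFactor (K * L) a c :=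
  ⟨hab.1.trans (by rw [mul_assoc]; gcongr; exact hbc.1),
    hbc.2.trans (by rw [mul_comm K, mul_assoc]; gcongr; exact hab.2)⟩

/-- A scale function: a positive function that changes at most by the factor `L` within a ball
whose radius is `R` times its value at the center. -/
structure SlowlyVarying {V : Type*} [PseudoMetricSpace V] (L R : ℝ) (δ : V → ℝ) : Prop where
  pos : ∀ x, 0 < δ x
  near : ∀ x y, dist x y < R * δ x → WithinFactor L (δ x) (δ y)

/-- A step between states `(point, potential)`. The point moves by less than `r` times the scale
`δ`, and the potential, which stays comparable to the scale, decays by the factor `θ`. Unlike the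
scale itself, the potential decays strictly along concatenations of chains. -/
structure ChainStep {V : Type*} [PseudoMetricSpace V] (δ : V → ℝ) (r θ K : ℝ) (s t : V × ℝ) :
    Prop where
  dist_lt : dist s.1 t.1 < r * δ s.1
  potential_le : t.2 ≤ θ * s.2
  withinFactor : WithinFactor K (δ t.1) t.2

/-- Two states are joined by finitely many chain steps. -/
abbrev Chain {V : Type*} [PseudoMetricSpace V] (δ : V → ℝ) (r θ K : ℝ) :
    V × ℝ → V × ℝ → Prop :=
  ReflTransGen (ChainStep δ r θ K)

/-- A decay factor so mild that `M` steps cost at most half of the potential. -/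
structure IsMildDecay (θ : ℝ) (M : ℕ) : Prop where
  nonneg : 0 ≤ θ
  le_one : θ ≤ 1
  half_le_pow : 1 / 2 ≤ θ ^ M

theorem exists_seq_of_reflTransGen {α : Type*} {r : α → α → Prop} {s t : α}
    (h : ReflTransGen r s t) :
    ∃ (m : ℕ) (f : ℕ → α), f 0 = s ∧ f m = t ∧ ∀ i < m, r (f i) (f (i + 1)) := by
  induction h using ReflTransGen.head_induction_on with
  | refl => exact ⟨0, fun _ => t, rfl, rfl, by simp⟩
  | @head u v huv _ ih =>
    obtain ⟨m, f, h0, hm, hf⟩ := ih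
    refine ⟨m + 1, fun i => Nat.casesOn i u f, rfl, hm, ?_⟩
    rintro (_ | i) hi
    · simpa [h0] using huv
    · exact hf i (by lia)

section Metric

variable {V : Type*} [PseudoMetricSpace V] {δ : V → ℝ} {r θ K L R φ ψ : ℝ} {m M : ℕ}

theorem SlowlyVarying.le_add (hδ : SlowlyVarying L R δ) (hR : 0 < R) (x y : V) :
    δ y ≤ L * δ x + dist x y / R := by
  rcases lt_or_ge (dist y x) (R * δ y) with hd | hd
  · exact (hδ.near y x hd).1.trans (le_add_of_nonneg_right (by positivity))
  · have hx := hδ.pos x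
    have hLx : δ x ≤ L * δ x := (hδ.near x x (by rw [dist_self]; positivity)).1
    have hy : δ y ≤ dist x y / R := by rwa [le_div_iff₀' hR, dist_comm]
    linarith

theorem ChainStep.withinFactor_of_seq {f : ℕ → V × ℝ}
    (hf : ∀ i < m, ChainStep δ r θ K (f i) (f (i + 1))) (h0 : WithinFactor K (δ (f 0).1) (f 0).2) :
    ∀ i ≤ m, WithinFactor K (δ (f i).1) (f i).2
  | 0, _ => h0
  | i + 1, hi => (hf i hi).withinFactor

theorem ChainStep.potential_le_pow_mul {f : ℕ → V × ℝ} (hθ : 0 ≤ θ)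
    (hf : ∀ i < m, ChainStep δ r θ K (f i) (f (i + 1))) (l : ℕ) :
    ∀ j, l + j ≤ m → (f (l + j)).2 ≤ θ ^ j * (f l).2
  | 0, _ => by simp
  | j + 1, hj =>
    calc (f (l + j + 1)).2 ≤ θ * (f (l + j)).2 := (hf (l + j) hj).potential_le
      _ ≤ θ * (θ ^ j * (f l).2) := by
        gcongr; exact potential_le_pow_mul hθ hf l j (by lia)
      _ = θ ^ (j + 1) * (f l).2 := by ring

theorem ChainStep.scale_le_of_seq {f : ℕ → V × ℝ} (hθ : 0 ≤ θ) (hK : 0 ≤ K)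
    (hf : ∀ i < m, ChainStep δ r θ K (f i) (f (i + 1))) (h0 : WithinFactor K (δ (f 0).1) (f 0).2)
    {l k : ℕ} (hlk : l ≤ k) (hk : k ≤ m) :
    δ (f k).1 ≤ K ^ 2 * θ ^ (k - l) * δ (f l).1 := by
  have hK_all := withinFactor_of_seq hf h0
  obtain ⟨j, rfl⟩ := Nat.exists_eq_add_of_le hlk
  rw [Nat.add_sub_cancel_left]
  calc δ (f (l + j)).1 ≤ K * (f (l + j)).2 := (hK_all _ hk).1
    _ ≤ K * (θ ^ j * (K * δ (f l).1)) := by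
      gcongr
      exact (potential_le_pow_mul hθ hf l j hk).trans (by gcongr; exact (hK_all l (by lia)).2)
    _ = K ^ 2 * θ ^ j * δ (f l).1 := by ring

theorem Chain.of_walk (hθ : IsMildDecay θ M) (hK : 0 ≤ K) (hφ : 0 ≤ φ) (hm0 : m ≠ 0)
    (hmM : m ≤ M) {z : ℕ → V} (hstep : ∀ j < m, dist (z j) (z (j + 1)) < r * δ (z j))
    (hcomp : ∀ j < m, δ (z j) ≤ K * (φ / 2) ∧ φ ≤ K * δ (z j))
    (hψ : ψ ≤ φ / 2) (hend : WithinFactor K (δ (z m)) ψ) :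
    Chain δ r θ K (z 0, φ) (z m, ψ) := by
  have half_le (j : ℕ) (hj : j ≤ M) : φ / 2 ≤ θ ^ j * φ := by
    have := hθ.half_le_pow.trans (pow_le_pow_of_le_one hθ.nonneg hθ.le_one hj)
    linarith [mul_le_mul_of_nonneg_right this hφ]
  have walk (j : ℕ) (hj : j < m) : Chain δ r θ K (z 0, φ) (z j, θ ^ j * φ) := by
    induction j with
    | zero => simpa using ReflTransGen.refl
    | succ j ih =>
      refine (ih (by lia)).tail ⟨hstep j (by lia), (by ring : θ ^ (j + 1) * φ = _).le, ?_, ?_⟩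
      · exact (hcomp _ hj).1.trans (by gcongr; exact half_le _ (by lia))
      · exact (mul_le_of_le_one_left hφ (pow_le_one₀ hθ.nonneg hθ.le_one)).trans (hcomp _ hj).2
  obtain ⟨j, rfl⟩ := Nat.exists_eq_add_one_of_ne_zero hm0
  refine (walk j j.lt_add_one).tail ⟨hstep j j.lt_add_one, ?_, hend⟩
  exact hψ.trans ((half_le _ hmM).trans_eq (by ring))

end Metric

theorem Chain.add_left {V : Type*} [SeminormedAddCommGroup V] {δ : V → ℝ} {r θ K : ℝ} {p : V}
    {s t : V × ℝ} (h : Chain (fun w => δ (p + w)) r θ K s t) :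
    Chain δ r θ K (p + s.1, s.2) (p + t.1, t.2) :=
  ReflTransGen.lift (fun s : V × ℝ => (p + s.1, s.2))
    (fun _ _ h => ⟨by simpa using h.dist_lt, h.potential_le, h.withinFactor⟩) _ _ h

section Segment

variable {V : Type*} [SeminormedAddCommGroup V] [NormedSpace ℝ V] {δ : V → ℝ}
  {r θ K L R B D φ ψ s ρ : ℝ} {M : ℕ}

theorem dist_lineMap_div_succ (x y : V) (M j : ℕ) :
    dist (AffineMap.lineMap x y ((j : ℝ) / M) : V)
      (AffineMap.lineMap x y (((j + 1 : ℕ) : ℝ) / M)) = dist x y / M := by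
  have hsub : (j : ℝ) / M - ((j + 1 : ℕ) : ℝ) / M = -(M : ℝ)⁻¹ := by push_cast; ring
  rw [dist_lineMap_lineMap, Real.dist_eq, hsub, abs_neg, abs_of_nonneg (by positivity),
    div_eq_inv_mul]

theorem lineMap_div_mem_segment (x y : V) {j M : ℕ} (hj : j ≤ M) :
    AffineMap.lineMap x y ((j : ℝ) / M) ∈ segment ℝ x y :=
  lineMap_mem_segment ℝ x y
    ⟨by positivity, div_le_one_of_le₀ (by exact_mod_cast hj) (by positivity)⟩

theorem Chain.of_segment (hθ : IsMildDecay θ M) (hK : 0 ≤ K) (hφ : 0 ≤ φ) {x y : V}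
    (hdist : ∀ z ∈ segment ℝ x y, dist x y < r * M * δ z)
    (hcomp : ∀ z ∈ segment ℝ x y, δ z ≤ K * (φ / 2) ∧ φ ≤ K * δ z)
    (hψ : ψ ≤ φ / 2) (hend : WithinFactor K (δ y) ψ) :
    Chain δ r θ K (x, φ) (y, ψ) := by
  have hM : M ≠ 0 := by
    rintro rfl
    have := hdist x (left_mem_segment ℝ x y)
    simp only [Nat.cast_zero, mul_zero, zero_mul] at this
    exact absurd dist_nonneg this.not_ge
  have hM' : (0 : ℝ) < M := by positivity
  have hlast : AffineMap.lineMap x y ((M : ℝ) / M) = y := by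
    rw [div_self hM'.ne', AffineMap.lineMap_apply_one]
  have h := Chain.of_walk (δ := δ) (r := r) (z := fun j => AffineMap.lineMap x y ((j : ℝ) / M))
    (ψ := ψ) hθ hK hφ hM le_rfl
    (fun j hj => by
      rw [dist_lineMap_div_succ, div_lt_iff₀ hM']
      exact (hdist _ (lineMap_div_mem_segment x y hj.le)).trans_eq (by ring))
    (fun j hj => hcomp _ (lineMap_div_mem_segment x y hj.le)) hψ (by rwa [hlast])
  rw [hlast] at h
  simpa using h

theorem SlowlyVarying.exists_chain_lt (hδ : SlowlyVarying L R δ) (hR : 0 < R)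
    (hθ : IsMildDecay θ M) (hM : B < r * M) (hr : 0 ≤ r) (hK : 1 ≤ K) (hK' : 2 * (L + B / R) ≤ K)
    (hhalf : ∀ x y, δ y < δ x → δ y ≤ δ x / 2) {x y : V} (hxy : dist x y ≤ B * δ x)
    (hlt : δ y < δ x) :
    ∃ z, δ z < δ x ∧ Chain δ r θ K (x, δ x) (z, δ z) := by
  classical
  have hx := hδ.pos x
  have hB : 0 ≤ B := nonneg_of_mul_nonneg_left (dist_nonneg.trans hxy) hx
  have hM' : (0 : ℝ) < M := pos_of_mul_pos_right (hB.trans_lt hM) hr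
  set z : ℕ → V := fun j => AffineMap.lineMap x y ((j : ℝ) / M)
  have z_zero : z 0 = x := by simp [z]
  have z_last : δ (z M) < δ x := by simpa [z, div_self hM'.ne'] using hlt
  have hsmaller : ∃ j, δ (z j) < δ x := ⟨M, z_last⟩
  set m := Nat.find hsmaller
  have hmin (j : ℕ) (hj : j < m) : δ x ≤ δ (z j) := not_lt.1 (Nat.find_min hsmaller hj)
  have hmM : m ≤ M := Nat.find_min' hsmaller z_last
  have hm : δ (z m) < δ x := Nat.find_spec hsmaller
  have hm0 : m ≠ 0 := fun h => by rw [h, z_zero] at hm; exact hm.false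
  have hupper (j : ℕ) (hj : j ≤ M) : δ (z j) ≤ (L + B / R) * δ x := by
    have hdist : dist x (z j) ≤ B * δ x := by
      rw [dist_comm]
      exact (segment_subset_closedBall_left x y (lineMap_div_mem_segment x y hj)).trans hxy
    calc δ (z j) ≤ L * δ x + dist x (z j) / R := hδ.le_add hR x (z j)
      _ ≤ L * δ x + B * δ x / R := by gcongr
      _ = (L + B / R) * δ x := by ring
  refine ⟨z m, hm, ?_⟩
  have h := Chain.of_walk (δ := δ) (r := r) (z := z) (K := K) hθ (by linarith) hx.le hm0 hmM
    (fun j hj => ?_) (fun j hj => ⟨?_, ?_⟩) (hhalf _ _ hm) (.of_one_le hK (hδ.pos _).le)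
  · rwa [z_zero] at h
  · rw [dist_lineMap_div_succ, div_lt_iff₀ hM']
    calc dist x y ≤ B * δ x := hxy
      _ < r * M * δ x := by gcongr
      _ ≤ r * M * δ (z j) := by gcongr; exact hmin j hj
      _ = r * δ (z j) * M := by ring
  · linarith [hupper j (hj.le.trans hmM), mul_le_mul_of_nonneg_right hK' hx.le]
  · exact (hmin j hj).trans (le_mul_of_one_le_left (hδ.pos _).le hK)

theorem Chain.of_segment_in_shell (hθ : IsMildDecay θ M) (hM : 4 * D < r * M) (hD : 1 ≤ D)
    (hs : 0 < s) {x y : V} (hshell : ∀ w ∈ segment ℝ x y, s ≤ ‖w‖ ∧ ‖w‖ ≤ 2 * s)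
    (hδ : ∀ w ∈ segment ℝ x y, WithinFactor D (δ w) ‖w‖)
    (hφ : 2 * D * s ≤ φ) (hφ' : φ ≤ 8 * D * s) (hψ : ψ ≤ φ / 2)
    (hend : WithinFactor (D * (8 * D)) (δ y) ψ) :
    Chain δ r θ (D * (8 * D)) (x, φ) (y, ψ) := by
  have hφ0 : 0 ≤ φ := le_trans (by positivity) hφ
  refine Chain.of_segment hθ (by positivity) hφ0 (fun w hw => ?_) (fun w hw => ⟨?_, ?_⟩) hψ hend
  · have hδw : 0 < δ w :=
      pos_of_mul_pos_right ((hs.trans_le (hshell w hw).1).trans_le (hδ w hw).2) (by linarith)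
    have hx := (hshell x (left_mem_segment ℝ x y)).2
    have hy := (hshell y (right_mem_segment ℝ x y)).2
    calc dist x y ≤ ‖x‖ + ‖y‖ := dist_le_norm_add_norm x y
      _ ≤ 4 * s := by linarith
      _ ≤ 4 * (D * δ w) := by gcongr; exact (hshell w hw).1.trans (hδ w hw).2
      _ = 4 * D * δ w := by ring
      _ < r * M * δ w := by gcongr
  · calc δ w ≤ D * ‖w‖ := (hδ w hw).1
      _ ≤ D * (8 * D * (φ / 2)) := by gcongr; nlinarith [(hshell w hw).2]
      _ = D * (8 * D) * (φ / 2) := by ring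
  · calc φ ≤ 8 * D * s := hφ'
      _ ≤ 8 * D * (D * δ w) := by gcongr; exact (hshell w hw).1.trans (hδ w hw).2
      _ = D * (8 * D) * δ w := by ring

theorem segment_half_smul_in_shell {u w : V} (hw : w ∈ segment ℝ u ((1 / 2 : ℝ) • u)) :
    ‖u‖ / 2 ≤ ‖w‖ ∧ ‖w‖ ≤ ‖u‖ := by
  obtain ⟨a, b, ha, hb, hab, rfl⟩ := hw
  have hnorm : ‖a • u + b • (1 / 2 : ℝ) • u‖ = (a + b / 2) * ‖u‖ := by
    rw [smul_smul, ← add_smul, norm_smul, Real.norm_of_nonneg (by positivity)]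
    ring
  rw [hnorm]
  constructor <;> nlinarith [norm_nonneg u]

theorem Chain.half_smul (hθ : IsMildDecay θ M) (hM : 4 * D < r * M) (hD : 1 ≤ D) {u : V}
    (hu : 0 < ‖u‖) (hδ : ∀ w, ‖u‖ / 2 ≤ ‖w‖ → ‖w‖ ≤ ‖u‖ → WithinFactor D (δ w) ‖w‖) :
    Chain δ r θ (D * (8 * D)) (u, 4 * D * ‖u‖)
      ((1 / 2 : ℝ) • u, 4 * D * ‖(1 / 2 : ℝ) • u‖) := by
  set v : V := (1 / 2 : ℝ) • u with hv
  have hvu : ‖u‖ = 2 * ‖v‖ := by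
    rw [hv, norm_smul, Real.norm_of_nonneg (by positivity)]; ring
  have hDv : 0 < D * ‖v‖ := mul_pos (by linarith) (by linarith)
  refine Chain.of_segment_in_shell (s := ‖v‖) hθ hM hD (by linarith) (fun w hw => ?_)
    (fun w hw => ?_) (by rw [hvu]; linarith) (by rw [hvu]; linarith) (by rw [hvu]; linarith)
    (.trans (by linarith) (by linarith) (hδ v (by linarith) (by linarith)) ⟨?_, ?_⟩)
  · have := segment_half_smul_in_shell hw
    constructor <;> linarith
  · exact hδ w (segment_half_smul_in_shell hw).1 (segment_half_smul_in_shell hw).2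
  · nlinarith
  · linarith

theorem exists_chain_radial (hθ : IsMildDecay θ M) (hM : 4 * D < r * M) (hD : 1 ≤ D)
    (hρ : 0 < ρ) (hδ : ∀ w, ρ ≤ ‖w‖ → ‖w‖ ≤ R → WithinFactor D (δ w) ‖w‖) {u : V}
    (hu : ρ ≤ ‖u‖) (huR : ‖u‖ ≤ R) :
    ∃ t : ℝ, 0 < t ∧ ρ ≤ ‖t • u‖ ∧ ‖t • u‖ ≤ 2 * ρ ∧
      Chain δ r θ (D * (8 * D)) (u, 4 * D * ‖u‖) (t • u, 4 * D * ‖t • u‖) := by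
  obtain ⟨k, hk⟩ : ∃ k : ℕ, ‖u‖ < 2 ^ k * ρ := by
    obtain ⟨k, hk⟩ := pow_unbounded_of_one_lt (‖u‖ / ρ) one_lt_two
    exact ⟨k, (div_lt_iff₀ hρ).1 hk⟩
  induction k generalizing u with
  | zero => rw [pow_zero, one_mul] at hk; exact absurd hu hk.not_ge
  | succ k ih =>
    rcases le_or_gt ‖u‖ (2 * ρ) with hu2 | hu2
    · exact ⟨1, one_pos, by simpa, by simpa, by simpa using .refl⟩
    have hhalf : ‖(1 / 2 : ℝ) • u‖ = ‖u‖ / 2 := by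
      rw [norm_smul, Real.norm_of_nonneg (by positivity)]; ring
    obtain ⟨t, ht, hρt, htρ, hchain⟩ := ih (u := (1 / 2 : ℝ) • u) (by linarith) (by linarith)
      (by rw [pow_succ] at hk; linarith)
    rw [← mul_smul] at hρt htρ hchain
    refine ⟨t * (1 / 2), by positivity, hρt, htρ, ReflTransGen.trans ?_ hchain⟩
    exact Chain.half_smul hθ hM hD (by linarith)
      fun w hw hwu => hδ w (by linarith) (hwu.trans huR)

end Segment

section Pi

variable {ι : Type*} [Fintype ι] {δ : (ι → ℝ) → ℝ} {r θ D R ρ σ : ℝ} {M : ℕ}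

theorem norm_const_sign_mul [Nonempty ι] (hσ : |σ| = 1) (hρ : 0 ≤ ρ) :
    ‖(fun _ => σ * ρ : ι → ℝ)‖ = ρ := by
  rw [pi_norm_const, norm_mul, Real.norm_eq_abs, hσ, one_mul, Real.norm_of_nonneg hρ]

theorem segment_subset_shell {u v : ι → ℝ} (i : ι) (hσ : |σ| = 1) (hu : ρ ≤ σ * u i)
    (hv : ρ ≤ σ * v i) (huR : ‖u‖ ≤ R) (hvR : ‖v‖ ≤ R) {w : ι → ℝ} (hw : w ∈ segment ℝ u v) :
    ρ ≤ ‖w‖ ∧ ‖w‖ ≤ R := by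
  constructor
  · have hconvex : Convex ℝ {x : ι → ℝ | ρ ≤ σ * x i} :=
      convex_halfSpace_ge (f := fun x : ι → ℝ => σ * x i)
        ⟨fun x y => by simp [mul_add], fun c x => by simp [mul_left_comm]⟩ ρ
    calc ρ ≤ σ * w i := hconvex.segment_subset hu hv hw
      _ ≤ |σ * w i| := le_abs_self _
      _ = ‖w i‖ := by rw [abs_mul, hσ, one_mul, Real.norm_eq_abs]
      _ ≤ ‖w‖ := norm_le_pi_norm w i
  · have := (convex_closedBall (0 : ι → ℝ) R).segment_subset (by simpa) (by simpa) hw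
    simpa using this

/-- The waypoint changes one coordinate at a time, so that on each leg some coordinate keeps its
sign and stays at least `ρ` in absolute value. -/
theorem exists_waypoint {v : ι → ℝ} (hσ : |σ| = 1) (hρ : 0 < ρ) (hv : ρ ≤ ‖v‖)
    (hv' : ‖v‖ ≤ 2 * ρ) (h : Nontrivial ι ∨ ∀ i, 0 < σ * v i) :
    ∃ w, (∀ x ∈ segment ℝ v w, ρ ≤ ‖x‖ ∧ ‖x‖ ≤ 2 * ρ) ∧
      ∀ x ∈ segment ℝ w (fun _ => σ * ρ), ρ ≤ ‖x‖ ∧ ‖x‖ ≤ 2 * ρ := by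
  classical
  obtain ⟨i, hi⟩ : ∃ i, ρ ≤ |v i| := by
    by_contra! hcon
    exact hv.not_gt ((pi_norm_lt_iff hρ).2 hcon)
  have : Nonempty ι := ⟨i⟩
  have hσσ : σ * σ = 1 := by rw [← abs_mul_abs_self, hσ, one_mul]
  have hσρ : ρ ≤ σ * (σ * ρ) := by rw [← mul_assoc, hσσ, one_mul]
  have htarget : ‖(fun _ => σ * ρ : ι → ℝ)‖ ≤ 2 * ρ := by
    rw [norm_const_sign_mul hσ hρ.le]; linarith
  rcases h with hnontrivial | hsign
  · obtain ⟨k, hki⟩ := exists_ne i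
    have hw : ‖Function.update v k (σ * ρ)‖ ≤ 2 * ρ := by
      refine (pi_norm_le_iff_of_nonneg (by positivity)).2 fun j => ?_
      rcases eq_or_ne j k with rfl | hj
      · simpa using (norm_le_pi_norm (fun _ => σ * ρ : ι → ℝ) j).trans htarget
      · simpa [hj] using (norm_le_pi_norm v j).trans hv'
    obtain ⟨τ, hτ, hτv⟩ : ∃ τ : ℝ, |τ| = 1 ∧ ρ ≤ τ * v i := by
      rcases abs_cases (v i) with ⟨h, -⟩ | ⟨h, -⟩
      · exact ⟨1, by simp, by linarith⟩
      · exact ⟨-1, by simp, by linarith⟩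
    refine ⟨Function.update v k (σ * ρ), fun x hx => ?_, fun x hx => ?_⟩
    · exact segment_subset_shell i hτ hτv (by simpa [hki.symm] using hτv) hv' hw hx
    · exact segment_subset_shell k hσ (by simpa using hσρ) hσρ hw htarget hx
  · have hvi : ρ ≤ σ * v i := by
      rwa [← abs_of_pos (hsign i), abs_mul, hσ, one_mul]
    refine ⟨v, fun x hx => ?_, fun x hx => segment_subset_shell i hσ hvi hσρ hv' htarget hx⟩
    rw [segment_same, Set.mem_singleton_iff] at hx
    exact hx ▸ ⟨hv, hv'⟩

theorem exists_chain_annulus [Nonempty ι] (hθ : IsMildDecay θ M) (hM : 4 * D < r * M)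
    (hD : 1 ≤ D) (hρ : 0 < ρ) (hρR : 2 * ρ ≤ R)
    (hδ : ∀ w, ρ ≤ ‖w‖ → ‖w‖ ≤ R → WithinFactor D (δ w) ‖w‖) (hσ : |σ| = 1) {u : ι → ℝ}
    (hu : ρ ≤ ‖u‖) (huR : ‖u‖ ≤ R) (h : Nontrivial ι ∨ ∀ i, 0 < σ * u i) :
    Chain δ r θ (D * (8 * D)) (u, 4 * D * ‖u‖) (fun _ => σ * ρ, δ fun _ => σ * ρ) := by
  obtain ⟨t, ht, hρt, htρ, hradial⟩ := exists_chain_radial hθ hM hD hρ hδ hu huR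
  obtain ⟨w, hleg₁, hleg₂⟩ := exists_waypoint hσ hρ hρt htρ <| h.imp_right fun h i => by
    rw [Pi.smul_apply, smul_eq_mul, mul_left_comm]
    exact mul_pos ht (h i)
  have hshell (x : ι → ℝ) (hx : ρ ≤ ‖x‖ ∧ ‖x‖ ≤ 2 * ρ) : WithinFactor D (δ x) ‖x‖ :=
    hδ x hx.1 (hx.2.trans hρR)
  have hw := hleg₁ w (right_mem_segment ℝ _ w)
  have htarget := hshell _ (hleg₂ _ (right_mem_segment ℝ _ _))
  rw [norm_const_sign_mul hσ hρ.le] at htarget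
  have hD2 : 1 ≤ D * (8 * D) := by nlinarith
  refine hradial.trans (ReflTransGen.trans (b := (w, 2 * D * ρ)) ?_ ?_)
  · refine Chain.of_segment_in_shell hθ hM hD hρ hleg₁ (fun x hx => hshell x (hleg₁ x hx))
      (by nlinarith) (by nlinarith) (by nlinarith)
      (.trans (by linarith) (by linarith) (hshell w hw) ⟨?_, ?_⟩)
    · nlinarith
    · nlinarith
  · exact Chain.of_segment_in_shell hθ hM hD hρ hleg₂ (fun x hx => hshell x (hleg₂ x hx)) le_rfl
      (by nlinarith) (by linarith [htarget.1])
      (.of_one_le hD2 (nonneg_of_mul_nonneg_right (hρ.le.trans htarget.2) (by linarith)))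

end Pi

section GreedyNet

variable {X : Type*} [PseudoMetricSpace X] {E F : Finset X} {T h : ℝ} {d : X → ℝ}

/-- A stage in the farthest-first enumeration of `E`: the points `F` enumerated so far cover `E`
up to distance `h`, and `d f` is the distance of `f` to its predecessors, with a value at least
`T` for the first point. -/
structure IsGreedyNet (E F : Finset X) (T : ℝ) (d : X → ℝ) (h : ℝ) : Prop where
  subset : F ⊆ E
  min_le_dist : ∀ e ∈ F, ∀ e' ∈ F, e ≠ e' → min (d e) (d e') ≤ dist e e'
  exists_dist_le : ∀ p ∈ E, ∃ f ∈ F, dist p f ≤ h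
  le : ∀ f ∈ F, h ≤ d f
  exists_lt_and_dist_le : ∀ t, h ≤ t → t < T → ∀ p ∈ E, ∃ f ∈ F, t < d f ∧ dist p f ≤ t

theorem isGreedyNet_singleton {e : X} (he : e ∈ E) (T : ℝ) :
    IsGreedyNet E {e} T (fun _ => max T (Metric.diam (E : Set X)))
      (Metric.diam (E : Set X)) := by
  have hdist (p : X) (hp : p ∈ E) : dist p e ≤ Metric.diam (E : Set X) :=
    Metric.dist_le_diam_of_mem E.finite_toSet.isBounded hp he
  refine ⟨by simpa, by simp, fun p hp => ⟨e, by simp, hdist p hp⟩, fun _ _ => le_max_right _ _, ?_⟩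
  exact fun t ht htT p hp => ⟨e, by simp, lt_max_of_lt_left htT, (hdist p hp).trans ht⟩

theorem exists_dist_le_infDist (hF : F.Nonempty) {e : X}
    (hfar : ∀ p ∈ E, p ∉ F → Metric.infDist p (F : Set X) ≤ Metric.infDist e (F : Set X)) {p : X}
    (hp : p ∈ E) : ∃ f ∈ F, dist p f ≤ Metric.infDist e (F : Set X) := by
  by_cases hpF : p ∈ F
  · exact ⟨p, hpF, by rw [dist_self]; exact Metric.infDist_nonneg⟩
  · obtain ⟨f, hf, hpf⟩ := F.finite_toSet.isCompact.exists_infDist_eq_dist hF p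
    exact ⟨f, hf, hpf ▸ hfar p hp hpF⟩

theorem IsGreedyNet.insert [DecidableEq X] (hF : IsGreedyNet E F T d h) (hF0 : F.Nonempty)
    {e : X} (heE : e ∈ E) (heF : e ∉ F)
    (hfar : ∀ p ∈ E, p ∉ F → Metric.infDist p (F : Set X) ≤ Metric.infDist e (F : Set X)) :
    IsGreedyNet E (insert e F) T (Function.update d e (Metric.infDist e (F : Set X)))
      (Metric.infDist e (F : Set X)) := by
  set h' := Metric.infDist e (F : Set X)
  have hcover (p : X) (hp : p ∈ E) : ∃ f ∈ F, dist p f ≤ h' := exists_dist_le_infDist hF0 hfar hp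
  have hh' : h' ≤ h := by
    obtain ⟨f, hf, hef⟩ := hF.exists_dist_le e heE
    exact (Metric.infDist_le_dist_of_mem hf).trans hef
  have hdF (f : X) (hf : f ∈ F) : Function.update d e h' f = d f :=
    Function.update_of_ne (fun hfe : f = e => heF (hfe ▸ hf)) _ _
  have hde : Function.update d e h' e = h' := Function.update_self _ _ _
  refine ⟨Finset.insert_subset heE hF.subset, ?_, fun p hp => ?_, ?_, fun t ht htT p hp => ?_⟩
  · simp only [Finset.mem_insert]
    rintro x (rfl | hx) y (rfl | hy) hxy
    · exact absurd rfl hxy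
    · rw [hde]
      exact (min_le_left _ _).trans (Metric.infDist_le_dist_of_mem hy)
    · rw [hde, dist_comm]
      exact (min_le_right _ _).trans (Metric.infDist_le_dist_of_mem hx)
    · rw [hdF x hx, hdF y hy]
      exact hF.min_le_dist x hx y hy hxy
  · exact (hcover p hp).imp fun f => And.imp_left Finset.mem_insert_of_mem
  · exact (Finset.forall_mem_insert _ _ _).2
      ⟨hde.ge, fun f hf => hdF f hf ▸ hh'.trans (hF.le f hf)⟩
  · rcases le_or_gt h t with hht | hth
    · obtain ⟨f, hf, htf, hpf⟩ := hF.exists_lt_and_dist_le t hht htT p hp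
      exact ⟨f, Finset.mem_insert_of_mem hf, (hdF f hf).symm ▸ htf, hpf⟩
    · obtain ⟨f, hf, hpf⟩ := hcover p hp
      exact ⟨f, Finset.mem_insert_of_mem hf, (hdF f hf).symm ▸ hth.trans_le (hF.le f hf),
        hpf.trans ht⟩

theorem exists_isGreedyNet (hE : E.Nonempty) (T : ℝ) : ∃ d h, IsGreedyNet E E T d h := by
  classical
  have enumerate (m : ℕ) (hm : 1 ≤ m) :
      m ≤ E.card → ∃ F d h, F.card = m ∧ IsGreedyNet E F T d h := by
    induction m, hm using Nat.le_induction with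
    | base =>
      obtain ⟨e, he⟩ := hE
      exact fun _ => ⟨{e}, _, _, Finset.card_singleton e, isGreedyNet_singleton he T⟩
    | succ m hm ih =>
      intro hmE
      obtain ⟨F, d, h, hFm, hF⟩ := ih (by lia)
      have hEF : (E \ F).Nonempty := by
        rw [← Finset.card_pos, Finset.card_sdiff_of_subset hF.subset]; lia
      obtain ⟨e, he, hfar⟩ := (E \ F).exists_max_image (Metric.infDist · (F : Set X)) hEF
      obtain ⟨heE, heF⟩ := Finset.mem_sdiff.1 he
      exact ⟨insert e F, _, _, by rw [Finset.card_insert_of_notMem heF, hFm],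
        hF.insert (Finset.card_pos.1 (by lia)) heE heF
          fun p hp hpF => hfar p (Finset.mem_sdiff.2 ⟨hp, hpF⟩)⟩
  obtain ⟨F, d, h, hFm, hF⟩ := enumerate E.card hE.card_pos le_rfl
  exact ⟨d, h, Finset.eq_of_subset_of_card_le hF.subset hFm.ge ▸ hF⟩

/-- Every superlevel set `{d > t}` with `0 ≤ t < T` is both `t`-separated and `t`-dense in `E`. -/
theorem exists_net_radius (hE : E.Nonempty) (T : ℝ) :
    ∃ d : X → ℝ, (∀ e ∈ E, ∀ e' ∈ E, e ≠ e' → min (d e) (d e') ≤ dist e e') ∧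
      ∀ t, 0 ≤ t → t < T → ∀ p ∈ E, ∃ e ∈ E, t < d e ∧ dist p e ≤ t := by
  obtain ⟨d, h, hd⟩ := exists_isGreedyNet hE T
  refine ⟨d, hd.min_le_dist, fun t ht htT p hp => ?_⟩
  rcases le_or_gt h t with hht | hth
  · exact hd.exists_lt_and_dist_le t hht htT p hp
  · exact ⟨p, hp, hth.trans_le (hd.le p hp), by rwa [dist_self]⟩

end GreedyNet

namespace AxisCube

variable {n : ℕ} {A B K : ℝ} {Q Q' : AxisCube n} {x y : Fin n → ℝ}

theorem side_pos (Q : AxisCube n) : 0 < Q.side := mul_pos two_pos Q.halfSide_pos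

theorem mem_toSet_iff :
    x ∈ Q.toSet ↔ ∀ i, Q.center i - Q.halfSide < x i ∧ x i ≤ Q.center i + Q.halfSide := by
  simp [toSet]

theorem mem_dilate_iff :
    x ∈ Q.dilate A ↔
      ∀ i, Q.center i - A * Q.halfSide < x i ∧ x i ≤ Q.center i + A * Q.halfSide := by
  simp [dilate]

theorem center_mem (Q : AxisCube n) : Q.center ∈ Q.toSet :=
  mem_toSet_iff.2 fun _ => ⟨sub_lt_self _ Q.halfSide_pos, (lt_add_of_pos_right _ Q.halfSide_pos).le⟩

theorem dilate_one (Q : AxisCube n) : Q.dilate 1 = Q.toSet := by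
  simp only [dilate, toSet, one_mul]

theorem dilate_mono (Q : AxisCube n) (h : A ≤ B) : Q.dilate A ⊆ Q.dilate B := by
  have hAB : A * Q.halfSide ≤ B * Q.halfSide := mul_le_mul_of_nonneg_right h Q.halfSide_pos.le
  exact Set.pi_mono fun _ _ => Set.Ioc_subset_Ioc (by linarith) (by linarith)

theorem toSet_subset_dilate (Q : AxisCube n) (hA : 1 ≤ A) : Q.toSet ⊆ Q.dilate A :=
  Q.dilate_one ▸ Q.dilate_mono hA

theorem dist_center_le_of_mem_dilate (hA : 0 ≤ A) (hx : x ∈ Q.dilate A) :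
    dist x Q.center ≤ A / 2 * Q.side := by
  rw [mem_dilate_iff] at hx
  have := Q.halfSide_pos
  rw [side, dist_pi_le_iff (by positivity)]
  intro i
  rw [Real.dist_eq, abs_le]
  constructor <;> linarith [(hx i).1, (hx i).2]

theorem dist_center_le_of_mem (hx : x ∈ Q.toSet) : dist x Q.center ≤ Q.side / 2 :=
  (dist_center_le_of_mem_dilate zero_le_one (Q.toSet_subset_dilate le_rfl hx)).trans_eq (by ring)

theorem mem_dilate_of_dist_lt {c : ℝ} (hx : x ∈ Q.toSet) (hxy : dist x y < c / 2 * Q.side) :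
    y ∈ Q.dilate (1 + c) := by
  rw [mem_toSet_iff] at hx
  rw [mem_dilate_iff]
  intro i
  have hi := (dist_le_pi_dist x y i).trans_lt hxy
  rw [side, Real.dist_eq, abs_lt] at hi
  constructor <;> linarith [(hx i).1, (hx i).2, hi.1, hi.2]

theorem exists_side_eq_zpow [NeZero n] (hQ : Q.IsDyadic) : ∃ k : ℤ, Q.side = (2 : ℝ) ^ k := by
  obtain ⟨k, j, h⟩ := hQ
  have hne : Q.toSet.Nonempty := ⟨_, Q.center_mem⟩
  have hproj := congrArg (Function.eval (0 : Fin n) '' ·) h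
  have hne' := h ▸ hne
  simp only [toSet] at hproj hne
  rw [Set.eval_image_univ_pi hne, Set.eval_image_univ_pi hne'] at hproj
  obtain ⟨hleft, hright⟩ :=
    (Set.Ioc_eq_Ioc_iff (Or.inl (by linarith [Q.halfSide_pos]))).1 hproj
  exact ⟨k, by rw [side]; linarith⟩

theorem side_le_half_of_lt [NeZero n] (hQ : Q.IsDyadic) (hQ' : Q'.IsDyadic)
    (h : Q'.side < Q.side) : Q'.side ≤ Q.side / 2 := by
  obtain ⟨k, hk⟩ := exists_side_eq_zpow hQ
  obtain ⟨k', hk'⟩ := exists_side_eq_zpow hQ'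
  rw [hk, hk'] at h ⊢
  have hkk' : k' ≤ k - 1 := Int.le_sub_one_of_lt ((zpow_lt_zpow_iff_right₀ one_lt_two).1 h)
  calc (2 : ℝ) ^ k' ≤ 2 ^ (k - 1) := zpow_le_zpow_right₀ one_le_two hkk'
    _ = 2 ^ k / 2 := by rw [zpow_sub_one₀ two_ne_zero, div_eq_mul_inv]

/-- The cell containing the center of `Q`, in the grid of mesh `s / 2` with origin `e`. Disjoint
cubes of side at least `s` have different cells, so counting cells counts cubes. -/
noncomputable def gridCell (e : Fin n → ℝ) (s : ℝ) (Q : AxisCube n) : Fin n → ℤ :=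
  fun i => ⌊(Q.center i - e i) / (s / 2)⌋

theorem gridCell_injOn {S : Set (AxisCube n)} (hS : S.PairwiseDisjoint toSet) (e : Fin n → ℝ)
    {s : ℝ} (hs : 0 < s) (hside : ∀ Q ∈ S, s ≤ Q.side) : S.InjOn (gridCell e s) := by
  intro Q hQ Q' hQ' heq
  refine hS.elim_set hQ hQ' Q'.center (mem_toSet_iff.2 fun i => ?_) Q'.center_mem
  have hi := Int.abs_sub_lt_one_of_floor_eq_floor (congrFun heq i)
  rw [← sub_div, abs_div, abs_of_pos (half_pos hs), div_lt_one (half_pos hs)] at hi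
  have hQs := hside Q hQ
  rw [side] at hQs
  constructor <;> linarith [(abs_lt.1 hi).1, (abs_lt.1 hi).2]

theorem gridCell_mem_Icc {e : Fin n → ℝ} {s : ℝ} (hs : 0 < s) (h : dist Q.center e ≤ K * s) :
    gridCell e s Q ∈ Set.Icc (fun _ => -⌈2 * K⌉) (fun _ => ⌈2 * K⌉) := by
  have hi (i : Fin n) : |Q.center i - e i| ≤ K * s :=
    Real.dist_eq (Q.center i) (e i) ▸ (dist_le_pi_dist Q.center e i).trans h
  refine ⟨fun i => ?_, fun i => ?_⟩
  · simp only [gridCell]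
    rw [← Int.floor_neg]
    refine Int.floor_le_floor ((le_div_iff₀ (half_pos hs)).2 ?_)
    linarith [(abs_le.1 (hi i)).1]
  · refine (Int.floor_le_floor ((div_le_iff₀ (half_pos hs)).2 ?_)).trans (Int.floor_le_ceil _)
    linarith [(abs_le.1 (hi i)).2]

theorem exists_ncard_le_of_pairwiseDisjoint (n : ℕ) (K : ℝ) :
    ∃ N : ℕ, ∀ S : Set (AxisCube n), S.PairwiseDisjoint toSet → ∀ (e : Fin n → ℝ) (s : ℝ), 0 < s →
      (∀ Q ∈ S, s ≤ Q.side ∧ dist Q.center e ≤ K * s) → S.Finite ∧ S.ncard ≤ N := by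
  set box : Set (Fin n → ℤ) := Set.Icc (fun _ => -⌈2 * K⌉) (fun _ => ⌈2 * K⌉)
  have hbox : box.Finite := Set.finite_Icc _ _
  refine ⟨box.ncard, fun S hS e s hs h => ?_⟩
  have hmaps : Set.MapsTo (gridCell e s) S box := fun Q hQ => gridCell_mem_Icc hs (h Q hQ).2
  have hinj : S.InjOn (gridCell e s) := gridCell_injOn hS e hs fun Q hQ => (h Q hQ).1
  exact ⟨.of_injOn hmaps hinj hbox, Set.ncard_le_ncard_of_injOn _ hmaps hinj hbox⟩

/-- The cubes of `CZ` to be charged to the point `e` and the length `w`: their side is comparable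
to `w` and at least a fixed fraction of their distance from `e`. -/
def cubesAtScale (CZ : Set (AxisCube n)) (B : ℝ) (e : Fin n → ℝ) (w : ℝ) : Set (AxisCube n) :=
  {Q ∈ CZ | dist e Q.center ≤ B * Q.side ∧ WithinFactor B w Q.side}

theorem exists_ncard_cubesAtScale_le (n : ℕ) (hB : 0 < B) :
    ∃ N : ℕ, ∀ CZ : Set (AxisCube n), CZ.PairwiseDisjoint toSet → ∀ e w,
      (cubesAtScale CZ B e w).Finite ∧ (cubesAtScale CZ B e w).ncard ≤ N := by
  obtain ⟨N, hN⟩ := exists_ncard_le_of_pairwiseDisjoint n (B ^ 3)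
  refine ⟨N, fun CZ hCZ e w => ?_⟩
  rcases (cubesAtScale CZ B e w).eq_empty_or_nonempty with hempty | ⟨Q₀, -, -, -, hw⟩
  · simp [hempty]
  have hw : 0 < w := pos_of_mul_pos_right (Q₀.side_pos.trans_le hw) hB.le
  refine hN _ (hCZ.subset (Set.sep_subset _ _)) e (w / B) (by positivity) ?_
  rintro Q ⟨-, hdist, hside⟩
  refine ⟨(div_le_iff₀' hB).2 hside.1, ?_⟩
  calc dist Q.center e ≤ B * Q.side := dist_comm e Q.center ▸ hdist
    _ ≤ B * (B * w) := by gcongr; exact hside.2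
    _ = B ^ 3 * (w / B) := by field_simp

end AxisCube

open AxisCube

theorem AxisCube.infsep_le_mul_side {n : ℕ} {E : Set (Fin n → ℝ)} {A : ℝ} {Q : AxisCube n}
    (hA : 0 ≤ A) (h : (E ∩ Q.dilate A).Nontrivial) : E.infsep ≤ A * Q.side := by
  obtain ⟨x, ⟨hxE, hx⟩, y, ⟨hyE, hy⟩, hxy⟩ := h
  calc E.infsep ≤ dist x y := Set.infsep_le_dist_of_mem hxE hyE hxy
    _ ≤ dist x Q.center + dist y Q.center := dist_triangle_right x y Q.center
    _ ≤ A / 2 * Q.side + A / 2 * Q.side :=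
      add_le_add (dist_center_le_of_mem_dilate hA hx) (dist_center_le_of_mem_dilate hA hy)
    _ = A * Q.side := by ring

theorem exists_isMildDecay (B : ℝ) {r : ℝ} (hr : 0 < r) :
    ∃ (M : ℕ) (c : ℝ), B < r * M ∧ 0 < c ∧ c < 1 ∧ IsMildDecay (1 - c) M := by
  obtain ⟨M, hM⟩ := exists_nat_gt (max 1 (B / r))
  obtain ⟨hM1, hMB⟩ := max_lt_iff.1 hM
  have hc : 1 / (2 * M : ℝ) < 1 := by rw [div_lt_one (by linarith)]; linarith
  refine ⟨M, 1 / (2 * M), (div_lt_iff₀' hr).1 hMB, by positivity, hc, by linarith,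
    sub_le_self _ (by positivity), ?_⟩
  calc (1 / 2 : ℝ) = 1 + M * -(1 / (2 * M)) := by field_simp; ring
    _ ≤ (1 + -(1 / (2 * M))) ^ M := one_add_mul_le_pow (by linarith) M
    _ = (1 - 1 / (2 * M)) ^ M := by rw [← sub_eq_add_neg]

namespace IsCZDecomposition

variable {n : ℕ} {cG θ K m : ℝ} {M : ℕ} {CZ : Set (AxisCube n)} {Q Q' : AxisCube n}
  {x : Fin n → ℝ}

theorem exists_mem (hCZ : IsCZDecomposition cG CZ) (x : Fin n → ℝ) : ∃ Q ∈ CZ, x ∈ Q.toSet := by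
  simpa using (Set.ext_iff.1 hCZ.cover x).2 trivial

/-- The cube of the decomposition that contains `x`. -/
noncomputable def cubeAt (hCZ : IsCZDecomposition cG CZ) (x : Fin n → ℝ) : AxisCube n :=
  (hCZ.exists_mem x).choose

/-- The side of the cube of the decomposition that contains `x`. -/
noncomputable def scale (hCZ : IsCZDecomposition cG CZ) (x : Fin n → ℝ) : ℝ :=
  (hCZ.cubeAt x).side

variable (hCZ : IsCZDecomposition cG CZ)
include hCZ

theorem cubeAt_mem (x : Fin n → ℝ) : hCZ.cubeAt x ∈ CZ := (hCZ.exists_mem x).choose_spec.1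

theorem mem_cubeAt (x : Fin n → ℝ) : x ∈ (hCZ.cubeAt x).toSet :=
  (hCZ.exists_mem x).choose_spec.2

theorem cubeAt_eq (hQ : Q ∈ CZ) (hx : x ∈ Q.toSet) : hCZ.cubeAt x = Q :=
  hCZ.disjoint.elim_set (hCZ.cubeAt_mem x) hQ x (hCZ.mem_cubeAt x) hx

theorem scale_center (hQ : Q ∈ CZ) : hCZ.scale Q.center = Q.side := by
  rw [scale, hCZ.cubeAt_eq hQ Q.center_mem]

theorem withinFactor_side (hQ : Q ∈ CZ) (hQ' : Q' ∈ CZ)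
    (h : (Q.dilate (1 + 10 * cG) ∩ Q'.dilate (1 + 10 * cG)).Nonempty) :
    WithinFactor 64 Q.side Q'.side := by
  obtain ⟨hle, hge⟩ := hCZ.goodGeometry Q hQ Q' hQ' h
  exact ⟨by linarith, hge⟩

theorem slowlyVarying (hcG : 0 < cG) : SlowlyVarying 64 (5 * cG) hCZ.scale where
  pos x := (hCZ.cubeAt x).side_pos
  near x y h := hCZ.withinFactor_side (hCZ.cubeAt_mem x) (hCZ.cubeAt_mem y)
    ⟨y, mem_dilate_of_dist_lt (hCZ.mem_cubeAt x) (h.trans_eq (by rw [scale]; ring)),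
      toSet_subset_dilate _ (by linarith) (hCZ.mem_cubeAt y)⟩

theorem scale_le_half_of_lt [NeZero n] {x y : Fin n → ℝ} (h : hCZ.scale y < hCZ.scale x) :
    hCZ.scale y ≤ hCZ.scale x / 2 :=
  side_le_half_of_lt (hCZ.dyadic _ (hCZ.cubeAt_mem x)) (hCZ.dyadic _ (hCZ.cubeAt_mem y)) h

theorem exists_scale_lt_of_not_isKeystone (h : ¬IsKeystone CZ (hCZ.cubeAt x)) :
    ∃ y, dist x y ≤ 51 * hCZ.scale x ∧ hCZ.scale y < hCZ.scale x := by
  obtain ⟨Q', hQ', ⟨y, hyQ', hy⟩, hlt⟩ : ∃ Q' ∈ CZ,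
      (Q'.toSet ∩ (hCZ.cubeAt x).dilate 100).Nonempty ∧ Q'.side < (hCZ.cubeAt x).side := by
    by_contra! hcon
    exact h ⟨hCZ.cubeAt_mem x, hcon⟩
  rw [← hCZ.cubeAt_eq hQ' hyQ'] at hlt
  refine ⟨y, ?_, hlt⟩
  have hx_center := dist_center_le_of_mem (hCZ.mem_cubeAt x)
  have hy_center := dist_center_le_of_mem_dilate (by norm_num) hy
  have hside := (hCZ.cubeAt x).side_pos
  rw [scale]
  linarith [dist_triangle_right x y (hCZ.cubeAt x).center]

theorem exists_chain_keystone [NeZero n] (hcG : 0 < cG) (hθ : IsMildDecay θ M)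
    (hM : 51 < cG / 2 * M) (hK : 2 * (64 + 51 / (5 * cG)) ≤ K) (hm : 0 < m)
    (hside : ∀ Q ∈ CZ, m ≤ Q.side) (x : Fin n → ℝ) :
    ∃ y, IsKeystone CZ (hCZ.cubeAt y) ∧
      Chain hCZ.scale (cG / 2) θ K (x, hCZ.scale x) (y, hCZ.scale y) := by
  have hK1 : 1 ≤ K := by
    have : 0 < 51 / (5 * cG) := by positivity
    linarith
  obtain ⟨k, hk⟩ : ∃ k : ℕ, hCZ.scale x < 2 ^ k * m := by
    obtain ⟨k, hk⟩ := pow_unbounded_of_one_lt (hCZ.scale x / m) one_lt_two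
    exact ⟨k, (div_lt_iff₀ hm).1 hk⟩
  induction k generalizing x with
  | zero =>
    rw [pow_zero, one_mul] at hk
    exact absurd (hside _ (hCZ.cubeAt_mem x)) hk.not_ge
  | succ k ih =>
    by_cases hkey : IsKeystone CZ (hCZ.cubeAt x)
    · exact ⟨x, hkey, .refl⟩
    · obtain ⟨y, hxy, hlt⟩ := hCZ.exists_scale_lt_of_not_isKeystone hkey
      obtain ⟨z, hz, hxz⟩ := (hCZ.slowlyVarying hcG).exists_chain_lt (by positivity) hθ hM
        (by positivity) hK1 hK (fun _ _ => hCZ.scale_le_half_of_lt) hxy hlt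
      obtain ⟨w, hw, hzw⟩ := ih z <| by
        have := hCZ.scale_le_half_of_lt hz
        rw [pow_succ] at hk
        linarith
      exact ⟨w, hw, hxz.trans hzw⟩

end IsCZDecomposition

section Cluster

variable {n : ℕ} {cG A B ε : ℝ} {δ d : (Fin n → ℝ) → ℝ} {E X : Finset (Fin n → ℝ)}
  {CZ : Set (AxisCube n)} {Q Q' : AxisCube n} {e p p' x y : Fin n → ℝ}

open Classical in
/-- The points of `E` within `A` sidelengths of the center of `Q`: the part of `E` that decides
whether `Q` is special. -/
noncomputable def cluster (E : Finset (Fin n → ℝ)) (A : ℝ) (Q : AxisCube n) :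
    Finset (Fin n → ℝ) :=
  {e ∈ E | dist e Q.center ≤ A * Q.side}

theorem mem_cluster : e ∈ cluster E A Q ↔ e ∈ E ∧ dist e Q.center ≤ A * Q.side := by
  simp [cluster]

/-- The cube `Q` sees its cluster as a single point of small scale: all distances and scales in
the cluster are at most `ε` times the side of `Q`. These are the cubes that are not special. -/
structure IsTight (δ : (Fin n → ℝ) → ℝ) (E : Finset (Fin n → ℝ)) (A ε : ℝ) (Q : AxisCube n) :
    Prop where
  scale_le : ∀ p ∈ cluster E A Q, δ p ≤ ε * Q.side
  dist_le : ∀ p ∈ cluster E A Q, ∀ p' ∈ cluster E A Q, dist p p' ≤ ε * Q.side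

theorem exists_mem_cluster (hA : 9 / 2 ≤ A) (hQE : ((E : Set (Fin n → ℝ)) ∩ Q.dilate 9).Nonempty) :
    ∃ e ∈ cluster E A Q, dist e Q.center ≤ 9 / 2 * Q.side := by
  obtain ⟨e, heE, he⟩ := hQE
  have hdist := dist_center_le_of_mem_dilate (by norm_num) he
  exact ⟨e, mem_cluster.2 ⟨heE, hdist.trans (by gcongr; exact Q.side_pos.le)⟩, hdist⟩

theorem IsTight.dist_center_le (hT : IsTight δ E A ε Q) (hA : 9 / 2 ≤ A) (hε : ε ≤ 1 / 2)
    (hQE : ((E : Set (Fin n → ℝ)) ∩ Q.dilate 9).Nonempty) (hp : p ∈ cluster E A Q) :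
    dist p Q.center ≤ 5 * Q.side := by
  obtain ⟨e, he, heQ⟩ := exists_mem_cluster hA hQE
  calc dist p Q.center ≤ dist p e + dist e Q.center := dist_triangle p e Q.center
    _ ≤ ε * Q.side + 9 / 2 * Q.side := add_le_add (hT.dist_le p hp e he) heQ
    _ ≤ 5 * Q.side := by nlinarith [Q.side_pos]

theorem IsTight.cluster_subset (hT : IsTight δ E A ε Q) (hcG : 0 ≤ cG) (hA : 400 + 33 * cG ≤ A)
    (hε : ε ≤ 1 / 2) (hQE : ((E : Set (Fin n → ℝ)) ∩ Q.dilate 9).Nonempty)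
    (hside : Q.side ≤ 64 * Q'.side) (h : (Q.dilate (1 + cG) ∩ Q'.dilate (1 + cG)).Nonempty) :
    cluster E A Q ⊆ cluster E A Q' := by
  intro e he
  obtain ⟨w, hw, hw'⟩ := h
  have hwQ := dist_center_le_of_mem_dilate (by linarith) hw
  have hwQ' := dist_center_le_of_mem_dilate (by linarith) hw'
  refine mem_cluster.2 ⟨(mem_cluster.1 he).1, ?_⟩
  have hs := Q'.side_pos
  calc dist e Q'.center ≤ dist e Q.center + dist Q.center w + dist w Q'.center :=
        dist_triangle4 e Q.center w Q'.center
    _ ≤ 5 * Q.side + (1 + cG) / 2 * Q.side + (1 + cG) / 2 * Q'.side := by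
        rw [dist_comm Q.center]
        gcongr
        exact hT.dist_center_le (by linarith) hε hQE he
    _ = (5 + (1 + cG) / 2) * Q.side + (1 + cG) / 2 * Q'.side := by ring
    _ ≤ (5 + (1 + cG) / 2) * (64 * Q'.side) + (1 + cG) / 2 * Q'.side := by gcongr
    _ = (705 / 2 + 65 / 2 * cG) * Q'.side := by ring
    _ ≤ A * Q'.side := by gcongr; linarith

/-- A point chosen to represent the cluster `X`, arbitrary if `X` is empty. -/
noncomputable def basePoint (X : Finset (Fin n → ℝ)) : Fin n → ℝ := Classical.epsilon (· ∈ X)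

theorem basePoint_mem (hX : X.Nonempty) : basePoint X ∈ X := Classical.epsilon_spec hX

/-- A radius around the base point beyond which the cluster looks like a single point. -/
noncomputable def clusterRadius (δ : (Fin n → ℝ) → ℝ) (X : Finset (Fin n → ℝ)) : ℝ :=
  6 * Metric.diam (X : Set (Fin n → ℝ)) + δ (basePoint X)

theorem scale_basePoint_le_clusterRadius : δ (basePoint X) ≤ clusterRadius δ X :=
  le_add_of_nonneg_left (mul_nonneg (by norm_num) Metric.diam_nonneg)

theorem dist_basePoint_le (hδ : 0 ≤ δ (basePoint X)) (he : e ∈ X) :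
    6 * dist (basePoint X) e ≤ clusterRadius δ X := by
  have hdist : dist (basePoint X) e ≤ Metric.diam (X : Set (Fin n → ℝ)) :=
    Metric.dist_le_diam_of_mem X.finite_toSet.isBounded (basePoint_mem ⟨e, he⟩) he
  rw [clusterRadius]
  linarith

theorem IsTight.clusterRadius_le (hT : IsTight δ E A ε Q) (hε : 0 ≤ ε)
    (hX : (cluster E A Q).Nonempty) : clusterRadius δ (cluster E A Q) ≤ 7 * ε * Q.side := by
  have hdiam : Metric.diam (cluster E A Q : Set (Fin n → ℝ)) ≤ ε * Q.side :=
    Metric.diam_le_of_forall_dist_le (mul_nonneg hε Q.side_pos.le) hT.dist_le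
  rw [clusterRadius]
  linarith [hT.scale_le _ (basePoint_mem hX)]

/-- In dimension one, the complement of a point `p` is disconnected, and this is the sign of the
component containing `x`. In higher dimensions the sign is `1`. -/
noncomputable def facingSign [NeZero n] (p x : Fin n → ℝ) : ℝ := if n = 1 ∧ x 0 < p 0 then -1 else 1

theorem abs_facingSign [NeZero n] (p x : Fin n → ℝ) : |facingSign p x| = 1 := by
  rw [facingSign]
  split_ifs <;> simp

theorem nontrivial_or_facingSign_mul_pos [NeZero n] (hxp : x ≠ p) :
    Nontrivial (Fin n) ∨ ∀ i, 0 < facingSign p x * (x - p) i := by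
  rcases eq_or_ne n 1 with rfl | hn
  · right
    intro i
    obtain rfl := Subsingleton.elim 0 i
    have hne : x 0 ≠ p 0 := fun h => hxp (funext fun j => Subsingleton.elim 0 j ▸ h)
    rw [facingSign, Pi.sub_apply]
    split_ifs with h
    · linarith [h.2]
    · linarith [lt_of_le_of_ne (not_lt.1 fun h' => h ⟨rfl, h'⟩) hne.symm]
  · exact .inl (Fin.nontrivial_iff_two_le.2 (by have := NeZero.ne n; lia))

theorem facingSign_eq_of_mem_dilate [NeZero n] (hx : x ∈ Q.dilate A) (hy : y ∈ Q.dilate A)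
    (hp : p ∉ Q.dilate A) : facingSign p x = facingSign p y := by
  rw [facingSign, facingSign]
  congr 1
  rw [eq_iff_iff, and_congr_right_iff]
  rintro rfl
  have hlt (x y : Fin 1 → ℝ) (hx : x ∈ Q.dilate A) (hy : y ∈ Q.dilate A) (h : x 0 < p 0) :
      y 0 < p 0 := by
    by_contra! h'
    simp only [mem_dilate_iff, Fin.forall_fin_one] at hx hy hp
    exact hp ⟨by linarith, by linarith⟩
  exact ⟨hlt x y hx hy, hlt y x hy hx⟩

/-- The point to which the tight cubes around the cluster `X` are joined, at distance
`clusterRadius δ X` from its base point, and in dimension one on the same side of it as `x`. -/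
noncomputable def clusterTarget [NeZero n] (δ : (Fin n → ℝ) → ℝ) (X : Finset (Fin n → ℝ))
    (x : Fin n → ℝ) : Fin n → ℝ :=
  basePoint X + fun _ => facingSign (basePoint X) x * clusterRadius δ X

theorem exists_mem_cubesAtScale_of_lt_dist (hε : 0 < ε) (hAB : 2 * A + ε ≤ B) (hεB : 4 ≤ ε * B)
    (hsep : ∀ e ∈ E, ∀ e' ∈ E, e ≠ e' → min (d e) (d e') ≤ dist e e')
    (hdense : ∀ t, 0 ≤ t → t < Metric.diam (E : Set (Fin n → ℝ)) →
      ∀ p ∈ E, ∃ e ∈ E, t < d e ∧ dist p e ≤ t)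
    (hQ : Q ∈ CZ) (hp : p ∈ cluster E A Q) (hp' : p' ∈ cluster E A Q)
    (hfar : ε * Q.side < dist p p') : ∃ e ∈ E, Q ∈ cubesAtScale CZ B e (d e) := by
  have hs := Q.side_pos
  have hεs : 0 < ε * Q.side := by positivity
  have hABs : (2 * A + ε) * Q.side ≤ B * Q.side := by gcongr
  obtain ⟨hpE, hpQ⟩ := mem_cluster.1 hp
  obtain ⟨hpE', hpQ'⟩ := mem_cluster.1 hp'
  have hA := dist_nonneg.trans hpQ
  have hdiam : ε / 4 * Q.side < Metric.diam (E : Set (Fin n → ℝ)) := by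
    linarith [Metric.dist_le_diam_of_mem E.finite_toSet.isBounded hpE hpE']
  obtain ⟨e, he, hde, hpe⟩ := hdense _ (by positivity) hdiam p hpE
  obtain ⟨e', he', hde', hpe'⟩ := hdense _ (by positivity) hdiam p' hpE'
  have hne : e ≠ e' := by
    rintro rfl
    linarith [dist_triangle_right p p' e]
  have heQ := dist_triangle_left e Q.center p
  have heQ' := dist_triangle_left e' Q.center p'
  have hee' : dist e e' ≤ B * Q.side := by linarith [dist_triangle_right e e' Q.center]
  have hside (f : Fin n → ℝ) (hf : ε / 4 * Q.side < d f) : Q.side ≤ B * d f := by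
    have hB : 0 ≤ B := (pos_of_mul_pos_right (four_pos.trans_le hεB) hε.le).le
    calc Q.side ≤ B * (ε / 4 * Q.side) := by nlinarith
      _ ≤ B * d f := by gcongr
  rcases min_le_iff.1 (hsep e he e' he' hne) with h | h
  · exact ⟨e, he, hQ, by linarith, h.trans hee', hside e hde⟩
  · exact ⟨e', he', hQ, by linarith, h.trans hee', hside e' hde'⟩

end Cluster

namespace IsCZDecomposition

variable {n : ℕ} {cG A B D ε r θ ρ : ℝ} {M : ℕ} {d : (Fin n → ℝ) → ℝ} {E : Finset (Fin n → ℝ)}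
  {CZ : Set (AxisCube n)} {Q Q' : AxisCube n} {p : Fin n → ℝ}
  (hCZ : IsCZDecomposition cG CZ)

include hCZ

theorem mem_cubesAtScale_scale (hcG : 0 < cG) (hB : 64 + A / (5 * cG) ≤ B) (hAB : A ≤ B)
    (hεB : 1 ≤ ε * B) (hQ : Q ∈ CZ) (hp : p ∈ cluster E A Q) (hlarge : ε * Q.side < hCZ.scale p) :
    Q ∈ cubesAtScale CZ B p (hCZ.scale p) := by
  have hs := Q.side_pos
  have hpQ := (mem_cluster.1 hp).2
  refine ⟨hQ, hpQ.trans (by gcongr), ?_, ?_⟩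
  · calc hCZ.scale p ≤ 64 * Q.side + dist Q.center p / (5 * cG) :=
          hCZ.scale_center hQ ▸ (hCZ.slowlyVarying hcG).le_add (by positivity) Q.center p
      _ ≤ 64 * Q.side + A * Q.side / (5 * cG) := by rw [dist_comm]; gcongr
      _ = (64 + A / (5 * cG)) * Q.side := by ring
      _ ≤ B * Q.side := by gcongr
  · have hB0 : 0 ≤ B := by
      have := dist_nonneg.trans hpQ
      exact (nonneg_of_mul_nonneg_left this hs).trans hAB
    calc Q.side ≤ ε * B * Q.side := le_mul_of_one_le_left hs.le hεB
      _ = B * (ε * Q.side) := by ring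
      _ ≤ B * hCZ.scale p := by gcongr

theorem exists_mem_cubesAtScale_of_not_isTight (hcG : 0 < cG) (hε : 0 < ε)
    (hB : 64 + A / (5 * cG) ≤ B) (hA : 0 ≤ A) (hAB : 2 * A + ε ≤ B) (hεB : 4 ≤ ε * B)
    (hsep : ∀ e ∈ E, ∀ e' ∈ E, e ≠ e' → min (d e) (d e') ≤ dist e e')
    (hdense : ∀ t, 0 ≤ t → t < Metric.diam (E : Set (Fin n → ℝ)) →
      ∀ p ∈ E, ∃ e ∈ E, t < d e ∧ dist p e ≤ t)
    (hQ : Q ∈ CZ) (hT : ¬IsTight hCZ.scale E A ε Q) :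
    ∃ e ∈ E, Q ∈ cubesAtScale CZ B e (hCZ.scale e) ∪ cubesAtScale CZ B e (d e) := by
  by_cases hlarge : ∃ p ∈ cluster E A Q, ε * Q.side < hCZ.scale p
  · obtain ⟨p, hp, hlarge⟩ := hlarge
    exact ⟨p, (mem_cluster.1 hp).1, .inl (hCZ.mem_cubesAtScale_scale hcG hB (by linarith)
      (by linarith) hQ hp hlarge)⟩
  · push Not at hlarge
    obtain ⟨p, hp, p', hp', hfar⟩ : ∃ p ∈ cluster E A Q, ∃ p' ∈ cluster E A Q,
        ε * Q.side < dist p p' := by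
      by_contra! hnear
      exact hT ⟨hlarge, hnear⟩
    obtain ⟨e, he, hQe⟩ :=
      exists_mem_cubesAtScale_of_lt_dist hε hAB hεB hsep hdense hQ hp hp' hfar
    exact ⟨e, he, .inr hQe⟩

omit hCZ in
theorem exists_ncard_not_isTight_le (n : ℕ) (hcG : 0 < cG) (hA : 0 ≤ A) (hε : 0 < ε) :
    ∃ N : ℕ, ∀ (CZ : Set (AxisCube n)) (hCZ : IsCZDecomposition cG CZ) (E : Finset (Fin n → ℝ)),
      E.Nonempty → {Q ∈ CZ | ¬IsTight hCZ.scale E A ε Q}.Finite ∧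
        {Q ∈ CZ | ¬IsTight hCZ.scale E A ε Q}.ncard ≤ N * E.card := by
  obtain ⟨B, hB, hAB, hεB⟩ : ∃ B, 64 + A / (5 * cG) ≤ B ∧ 2 * A + ε ≤ B ∧ 4 ≤ ε * B :=
    ⟨max (64 + A / (5 * cG)) (max (2 * A + ε) (4 / ε)), le_max_left _ _,
      (le_max_left _ _).trans (le_max_right _ _),
      (div_le_iff₀' hε).1 ((le_max_right _ _).trans (le_max_right _ _))⟩
  obtain ⟨N, hN⟩ := exists_ncard_cubesAtScale_le n (B := B) (by linarith)
  refine ⟨N + N, fun CZ hCZ E hE => ?_⟩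
  obtain ⟨d, hsep, hdense⟩ := exists_net_radius hE (Metric.diam (E : Set (Fin n → ℝ)))
  set S : (Fin n → ℝ) → Set (AxisCube n) := fun e =>
    cubesAtScale CZ B e (hCZ.scale e) ∪ cubesAtScale CZ B e (d e)
  have hS (e : Fin n → ℝ) : (S e).Finite ∧ (S e).ncard ≤ N + N :=
    ⟨(hN CZ hCZ.disjoint e _).1.union (hN CZ hCZ.disjoint e _).1,
      (Set.ncard_union_le _ _).trans
        (add_le_add (hN CZ hCZ.disjoint e _).2 (hN CZ hCZ.disjoint e _).2)⟩
  have hsub : {Q ∈ CZ | ¬IsTight hCZ.scale E A ε Q} ⊆ ⋃ e ∈ E, S e := fun Q hQ =>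
    Set.mem_iUnion₂.2 <| by
      simpa only [exists_prop] using hCZ.exists_mem_cubesAtScale_of_not_isTight hcG hε
        hB hA hAB hεB hsep hdense hQ.1 hQ.2
  have hfin : (⋃ e ∈ E, S e).Finite := E.finite_toSet.biUnion fun e _ => (hS e).1
  refine ⟨hfin.subset hsub, ?_⟩
  calc {Q ∈ CZ | ¬IsTight hCZ.scale E A ε Q}.ncard
      ≤ (⋃ e ∈ E, S e).ncard := Set.ncard_le_ncard hsub hfin
    _ ≤ ∑ e ∈ E, (S e).ncard := E.set_ncard_biUnion_le S
    _ ≤ E.card • (N + N) := Finset.sum_le_card_nsmul _ _ _ fun e _ => (hS e).2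
    _ = (N + N) * E.card := mul_comm _ _

theorem exists_mem_dist_le (hE : ∀ Q ∈ CZ, ((E : Set (Fin n → ℝ)) ∩ Q.dilate 9).Nonempty)
    (x : Fin n → ℝ) : ∃ e ∈ E, dist e x ≤ 5 * hCZ.scale x := by
  obtain ⟨e, heE, he⟩ := hE _ (hCZ.cubeAt_mem x)
  have he_center := dist_center_le_of_mem_dilate (by norm_num) he
  have hx_center := dist_center_le_of_mem (hCZ.mem_cubeAt x)
  refine ⟨e, heE, ?_⟩
  rw [scale]
  linarith [dist_triangle_right e x (hCZ.cubeAt x).center]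

theorem withinFactor_scale_annulus (hcG : 0 < cG) (hD : 64 + 51 / (5 * cG) ≤ D) (hA : 400 ≤ A)
    (hE : ∀ Q ∈ CZ, ((E : Set (Fin n → ℝ)) ∩ Q.dilate 9).Nonempty)
    (hpQ : dist p Q.center ≤ 5 * Q.side) (hpρ : hCZ.scale p ≤ ρ)
    (hρ : ∀ e ∈ cluster E A Q, 6 * dist p e ≤ ρ) {w : Fin n → ℝ} (hw : ρ ≤ ‖w‖)
    (hwQ : ‖w‖ ≤ 6 * Q.side) : WithinFactor D (hCZ.scale (p + w)) ‖w‖ := by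
  have hpw : dist p (p + w) = ‖w‖ := by simp
  constructor
  · have hmono : 1 / (5 * cG) ≤ 51 / (5 * cG) := by gcongr; norm_num
    calc hCZ.scale (p + w) ≤ 64 * hCZ.scale p + dist p (p + w) / (5 * cG) :=
          (hCZ.slowlyVarying hcG).le_add (by positivity) p (p + w)
      _ ≤ 64 * ‖w‖ + ‖w‖ / (5 * cG) := by rw [hpw]; gcongr; exact hpρ.trans hw
      _ = (64 + 1 / (5 * cG)) * ‖w‖ := by ring
      _ ≤ D * ‖w‖ := by gcongr; linarith
  · have hscale : 0 < hCZ.scale (p + w) := (hCZ.slowlyVarying hcG).pos _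
    have h6 : ‖w‖ ≤ 6 * hCZ.scale (p + w) := by
      obtain ⟨e, he, hew⟩ := hCZ.exists_mem_dist_le hE (p + w)
      by_cases heQ : e ∈ cluster E A Q
      · linarith [hρ e heQ, dist_triangle p e (p + w)]
      · have hfar : A * Q.side < dist e Q.center := not_le.1 fun h => heQ (mem_cluster.2 ⟨he, h⟩)
        have hA' : 400 * Q.side ≤ A * Q.side := by gcongr; exact Q.side_pos.le
        linarith [dist_triangle4 e (p + w) p Q.center, dist_comm (p + w) p]
    have : 0 < 51 / (5 * cG) := by positivity
    exact h6.trans (by gcongr; linarith)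

theorem clusterRadius_le_dist (hcG : 0 < cG) (hA : 9 / 2 ≤ A) (hε : 0 ≤ ε) (hε' : ε ≤ 1 / 128)
    (hεG : ε ≤ cG / 4) (hQ : Q ∈ CZ) (hT : IsTight hCZ.scale E A ε Q)
    (hQE : ((E : Set (Fin n → ℝ)) ∩ Q.dilate 9).Nonempty) :
    clusterRadius hCZ.scale (cluster E A Q) ≤ dist (basePoint (cluster E A Q)) Q.center := by
  have hX : (cluster E A Q).Nonempty := (exists_mem_cluster hA hQE).imp fun _ => And.left
  set p := basePoint (cluster E A Q)
  have hs := Q.side_pos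
  have hscale : hCZ.scale p ≤ Q.side / 128 := by
    nlinarith [hT.scale_le p (basePoint_mem hX)]
  have hle : Q.side ≤ 64 * hCZ.scale p + dist p Q.center / (5 * cG) :=
    hCZ.scale_center hQ ▸ (hCZ.slowlyVarying hcG).le_add (by positivity) p Q.center
  calc clusterRadius hCZ.scale (cluster E A Q) ≤ 7 * ε * Q.side := hT.clusterRadius_le hε hX
    _ ≤ Q.side / 2 * (5 * cG) := by nlinarith
    _ ≤ dist p Q.center := (le_div_iff₀ (by positivity)).1 (by linarith)

theorem exists_chain_clusterTarget [NeZero n] (hcG : 0 < cG) (hθ : IsMildDecay θ M)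
    (hM : 4 * D < r * M) (hD : 64 + 51 / (5 * cG) ≤ D) (hA : 400 ≤ A) (hε : 0 ≤ ε)
    (hε' : ε ≤ 1 / 128) (hεG : ε ≤ cG / 4)
    (hE : ∀ Q ∈ CZ, ((E : Set (Fin n → ℝ)) ∩ Q.dilate 9).Nonempty) (hQ : Q ∈ CZ)
    (hT : IsTight hCZ.scale E A ε Q) :
    ∃ φ y, y = clusterTarget hCZ.scale (cluster E A Q) Q.center ∧
      WithinFactor (D * (8 * D)) Q.side φ ∧
      Chain hCZ.scale r θ (D * (8 * D)) (Q.center, φ) (y, hCZ.scale y) := by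
  have hX : (cluster E A Q).Nonempty :=
    (exists_mem_cluster (by linarith) (hE Q hQ)).imp fun _ => And.left
  have hD1 : 1 ≤ D := by
    have : 0 < 51 / (5 * cG) := by positivity
    linarith
  have hs := Q.side_pos
  set p := basePoint (cluster E A Q)
  set ρ := clusterRadius hCZ.scale (cluster E A Q)
  have hscale : 0 < hCZ.scale p := (hCZ.slowlyVarying hcG).pos p
  have hpρ : hCZ.scale p ≤ ρ := scale_basePoint_le_clusterRadius
  have hρQ : 2 * ρ ≤ 6 * Q.side := by
    nlinarith [hT.clusterRadius_le hε hX]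
  have hpQ : dist p Q.center ≤ 5 * Q.side :=
    hT.dist_center_le (by linarith) (by linarith) (hE Q hQ) (basePoint_mem hX)
  have hnorm : ‖Q.center - p‖ = dist p Q.center := by rw [← dist_eq_norm, dist_comm]
  have hlow : ρ ≤ ‖Q.center - p‖ :=
    hnorm ▸ hCZ.clusterRadius_le_dist hcG (by linarith) hε hε' hεG hQ hT (hE Q hQ)
  have hhigh : ‖Q.center - p‖ ≤ 6 * Q.side := by linarith
  have hannulus (w : Fin n → ℝ) : ρ ≤ ‖w‖ → ‖w‖ ≤ 6 * Q.side →
      WithinFactor D (hCZ.scale (p + w)) ‖w‖ :=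
    hCZ.withinFactor_scale_annulus hcG hD hA hE hpQ hpρ fun e => dist_basePoint_le hscale.le
  have hcenter : Q.center ≠ p :=
    sub_ne_zero.1 (norm_pos_iff.1 ((hscale.trans_le hpρ).trans_le hlow))
  have hchain := exists_chain_annulus (δ := fun w => hCZ.scale (p + w)) hθ hM hD1
    (hscale.trans_le hpρ) hρQ hannulus (abs_facingSign p Q.center) hlow hhigh
    (nontrivial_or_facingSign_mul_pos hcenter)
  have hside := hannulus _ hlow hhigh
  rw [add_sub_cancel, hCZ.scale_center hQ] at hside
  refine ⟨4 * D * ‖Q.center - p‖, _, rfl,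
    hside.trans (by linarith) (by linarith) ⟨?_, ?_⟩, ?_⟩
  · have hD32 : 1 ≤ 8 * D * (4 * D) := by nlinarith
    exact (le_mul_of_one_le_left (norm_nonneg _) hD32).trans_eq (by ring)
  · nlinarith [norm_nonneg (Q.center - p)]
  · have hpchain := hchain.add_left
    simp only [add_sub_cancel] at hpchain
    exact hpchain

theorem basePoint_notMem_dilate (hcG : 0 ≤ cG) (hA : 9 / 2 ≤ A) (hε : ε ≤ 1 / 128)
    (hQ : Q ∈ CZ) (hQE : ((E : Set (Fin n → ℝ)) ∩ Q.dilate 9).Nonempty)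
    (hT : IsTight hCZ.scale E A ε Q) : basePoint (cluster E A Q) ∉ Q.dilate (1 + cG) := by
  intro hmem
  set p := basePoint (cluster E A Q)
  have hscale : hCZ.scale p ≤ ε * Q.side :=
    hT.scale_le p (basePoint_mem ((exists_mem_cluster hA hQE).imp fun _ => And.left))
  have hside : Q.side ≤ 64 * hCZ.scale p :=
    (hCZ.withinFactor_side hQ (hCZ.cubeAt_mem p) ⟨p, Q.dilate_mono (by linarith) hmem,
      toSet_subset_dilate _ (by linarith) (hCZ.mem_cubeAt p)⟩).1
  nlinarith [Q.side_pos]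

theorem clusterTarget_eq_of_inter_nonempty [NeZero n] (hcG : 0 ≤ cG) (hA : 400 + 33 * cG ≤ A)
    (hε : ε ≤ 1 / 128) (hE : ∀ Q ∈ CZ, ((E : Set (Fin n → ℝ)) ∩ Q.dilate 9).Nonempty)
    (hQ : Q ∈ CZ) (hQ' : Q' ∈ CZ) (hT : IsTight hCZ.scale E A ε Q)
    (hT' : IsTight hCZ.scale E A ε Q') (h : (Q.dilate (1 + cG) ∩ Q'.dilate (1 + cG)).Nonempty) :
    clusterTarget hCZ.scale (cluster E A Q) Q.center =
      clusterTarget hCZ.scale (cluster E A Q') Q'.center := by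
  obtain ⟨hside, hside'⟩ := hCZ.withinFactor_side hQ hQ' <|
    h.mono (Set.inter_subset_inter (Q.dilate_mono (by linarith)) (Q'.dilate_mono (by linarith)))
  have hX : cluster E A Q = cluster E A Q' := Finset.Subset.antisymm
    (hT.cluster_subset hcG hA (by linarith) (hE Q hQ) hside h)
    (hT'.cluster_subset hcG hA (by linarith) (hE Q' hQ') hside' (Set.inter_comm _ _ ▸ h))
  have hp := hCZ.basePoint_notMem_dilate hcG (by linarith) hε hQ (hE Q hQ) hT
  have hp' := hCZ.basePoint_notMem_dilate hcG (by linarith) hε hQ' (hE Q' hQ') hT'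
  have hcenter (Q : AxisCube n) : Q.center ∈ Q.dilate (1 + cG) :=
    Q.toSet_subset_dilate (by linarith) Q.center_mem
  obtain ⟨w, hw, hw'⟩ := h
  have hsign : facingSign (basePoint (cluster E A Q')) Q.center =
      facingSign (basePoint (cluster E A Q')) Q'.center :=
    (facingSign_eq_of_mem_dilate (hcenter Q) hw (hX ▸ hp)).trans
      (facingSign_eq_of_mem_dilate hw' (hcenter Q') hp')
  rw [clusterTarget, clusterTarget, hX, hsign]

end IsCZDecomposition

/-- The sequence `S 1 = Q, …, S L` of neighboring cubes of `CZ` ends in a keystone cube, and its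
sides decay geometrically with constant `C` and ratio `1 - c`. -/
structure IsKeystoneDescent {n : ℕ} (cG C c : ℝ) (CZ : Set (AxisCube n)) (Q : AxisCube n) (L : ℕ)
    (S : ℕ → AxisCube n) : Prop where
  one_le : 1 ≤ L
  mem : ∀ l, 1 ≤ l → l ≤ L → S l ∈ CZ
  first : S 1 = Q
  isKeystone : IsKeystone CZ (S L)
  adjacent : ∀ l, 1 ≤ l → l < L →
    ((S l).dilate (1 + cG) ∩ (S (l + 1)).dilate (1 + cG)).Nonempty
  side_le : ∀ l k, 1 ≤ l → l ≤ k → k ≤ L → (S k).side ≤ C * (1 - c) ^ (k - l) * (S l).side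

namespace IsCZDecomposition

variable {n : ℕ} {cG A C D K c ε φ : ℝ} {M : ℕ} {E : Finset (Fin n → ℝ)} {CZ : Set (AxisCube n)}
  {Q : AxisCube n} {t : (Fin n → ℝ) × ℝ} (hCZ : IsCZDecomposition cG CZ)

include hCZ

theorem exists_isKeystoneDescent_of_chain (hcG : 0 ≤ cG) (hc : c ≤ 1) (hK : 0 ≤ K)
    (hC : K ^ 2 ≤ C) (hQ : Q ∈ CZ) (hφ : WithinFactor K Q.side φ)
    (hchain : Chain hCZ.scale (cG / 2) (1 - c) K (Q.center, φ) t)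
    (hkey : IsKeystone CZ (hCZ.cubeAt t.1)) :
    ∃ L S, IsKeystoneDescent cG C c CZ Q L S ∧ S L = hCZ.cubeAt t.1 := by
  obtain ⟨m, f, h0, rfl, hf⟩ := exists_seq_of_reflTransGen hchain
  have hdecay := @ChainStep.scale_le_of_seq _ _ hCZ.scale (cG / 2) (1 - c) K m f (by linarith) hK
    hf (by rwa [h0, hCZ.scale_center hQ])
  refine ⟨m + 1, fun l => hCZ.cubeAt (f (l - 1)).1, ⟨by lia, fun l _ _ => hCZ.cubeAt_mem _, ?_,
    hkey, fun l hl hlm => ?_, fun l k hl hlk hk => ?_⟩, rfl⟩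
  · simpa only [Nat.sub_self, h0] using hCZ.cubeAt_eq hQ Q.center_mem
  · obtain ⟨i, rfl⟩ := Nat.exists_eq_add_of_le' hl
    exact ⟨(f (i + 1)).1, mem_dilate_of_dist_lt (hCZ.mem_cubeAt _) (hf i (by lia)).dist_lt,
      toSet_subset_dilate _ (by linarith) (hCZ.mem_cubeAt _)⟩
  · have hle := hdecay (l := l - 1) (k := k - 1) (by lia) (by lia)
    rw [Nat.sub_sub_sub_cancel_right hl] at hle
    have hs := (hCZ.cubeAt (f (l - 1)).1).side_pos
    have hpow : 0 ≤ (1 - c) ^ (k - l) := pow_nonneg (by linarith) _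
    exact hle.trans
      (mul_le_mul_of_nonneg_right (mul_le_mul_of_nonneg_right hC hpow) hs.le)

theorem exists_isKeystoneDescent [NeZero n] (hcG : 0 < cG) (hθ : IsMildDecay (1 - c) M)
    (hM : 4 * D < cG / 2 * M) (hD : 64 + 51 / (5 * cG) ≤ D) (hC : (D * (8 * D)) ^ 2 ≤ C)
    (hA : 400 ≤ A) (hε : 0 ≤ ε) (hε' : ε ≤ 1 / 128) (hεG : ε ≤ cG / 4)
    (hE : ∀ Q ∈ CZ, ((E : Set (Fin n → ℝ)) ∩ Q.dilate 9).Nontrivial) (hE₀ : E.Nontrivial) :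
    ∃ key : (Fin n → ℝ) → AxisCube n, ∀ Q ∈ CZ, ∃ L S, IsKeystoneDescent cG C c CZ Q L S ∧
      (IsTight hCZ.scale E A ε Q →
        S L = key (clusterTarget hCZ.scale (cluster E A Q) Q.center)) := by
  have h51 : 0 < 51 / (5 * cG) := by positivity
  have hK : 1 ≤ D * (8 * D) := by nlinarith
  have hside (Q : AxisCube n) (hQ : Q ∈ CZ) : (E : Set (Fin n → ℝ)).infsep / 9 ≤ Q.side := by
    linarith [infsep_le_mul_side (by norm_num) (hE Q hQ)]
  have hinfsep := div_pos (E.infsep_pos_iff_nontrivial.2 hE₀) (by norm_num : (0 : ℝ) < 9)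
  choose z hz hchain using fun x => hCZ.exists_chain_keystone hcG hθ (by linarith)
    (by nlinarith : _ ≤ D * (8 * D)) hinfsep hside x
  have hc : c ≤ 1 := sub_nonneg.1 hθ.nonneg
  refine ⟨fun x => hCZ.cubeAt (z x), fun Q hQ => ?_⟩
  by_cases hT : IsTight hCZ.scale E A ε Q
  · obtain ⟨φ, y, rfl, hφ, hQy⟩ := hCZ.exists_chain_clusterTarget hcG hθ hM hD hA hε hε' hεG
      (fun Q hQ => (hE Q hQ).nonempty) hQ hT
    obtain ⟨L, S, hS, hSL⟩ := hCZ.exists_isKeystoneDescent_of_chain hcG.le hc (by linarith) hC hQ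
      hφ (hQy.trans (hchain _)) (hz _)
    exact ⟨L, S, hS, fun _ => hSL⟩
  · obtain ⟨L, S, hS, -⟩ := hCZ.exists_isKeystoneDescent_of_chain hcG.le hc (by linarith) hC hQ
      (.of_one_le hK Q.side_pos.le) (hCZ.scale_center hQ ▸ hchain Q.center) (hz _)
    exact ⟨L, S, hS, fun h => absurd h hT⟩

end IsCZDecomposition

theorem mainTheorem5 (n : ℕ) (hn : 1 ≤ n) (cG : ℝ) (hcG : 0 < cG) :
    ∃ C c : ℝ, 0 < C ∧ 0 < c ∧ c < 1 ∧
      ∀ (CZ : Set (AxisCube n)) (E : Finset (Fin n → ℝ)),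
        IsCZDecomposition cG CZ →
        2 ≤ E.card →
        (∀ Q ∈ CZ, 2 ≤ ((E : Set (Fin n → ℝ)) ∩ Q.dilate 9).ncard) →
        ∃ (special : Set (AxisCube n)) (L : AxisCube n → ℕ) (S : AxisCube n → ℕ → AxisCube n),
          special ⊆ CZ ∧
          (special.Finite ∧ (special.ncard : ℝ) ≤ C * (E.card : ℝ)) ∧
          (∀ Q ∈ CZ,
            1 ≤ L Q ∧
            (∀ l, 1 ≤ l → l ≤ L Q → S Q l ∈ CZ) ∧
            S Q 1 = Q ∧
            IsKeystone CZ (S Q (L Q)) ∧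
            (∀ l, 1 ≤ l → l < L Q →
              ((S Q l).dilate (1 + cG) ∩ (S Q (l + 1)).dilate (1 + cG)).Nonempty) ∧
            (∀ l k, 1 ≤ l → l ≤ k → k ≤ L Q →
              (S Q k).side ≤ C * (1 - c) ^ (k - l) * (S Q l).side)) ∧
          (∀ Q ∈ CZ \ special, ∀ Q' ∈ CZ \ special,
            (Q.dilate (1 + cG) ∩ Q'.dilate (1 + cG)).Nonempty →
              S Q (L Q) = S Q' (L Q')) := by
  have : NeZero n := ⟨by lia⟩
  set D : ℝ := 64 + 51 / (5 * cG)
  set A : ℝ := 400 + 33 * cG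
  set ε : ℝ := min (1 / 128) (cG / 4)
  have hA : 400 ≤ A := le_add_of_nonneg_right (by positivity)
  have hε : 0 < ε := lt_min (by norm_num) (by positivity)
  obtain ⟨M, c, hM, hc₀, hc₁, hθ⟩ := exists_isMildDecay (4 * D) (half_pos hcG)
  obtain ⟨N, hN⟩ := IsCZDecomposition.exists_ncard_not_isTight_le n hcG (by linarith : 0 ≤ A) hε
  refine ⟨(D * (8 * D)) ^ 2 + N, c, by positivity, hc₀, hc₁, fun CZ E hCZ hE₂ hE₉ => ?_⟩
  have hE (Q) (hQ : Q ∈ CZ) := (Set.one_lt_ncard_iff_nontrivial_and_finite.1 (hE₉ Q hQ)).1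
  have hE₀ : E.Nontrivial := Finset.one_lt_card_iff_nontrivial.1 hE₂
  obtain ⟨key, hkey⟩ := hCZ.exists_isKeystoneDescent hcG hθ hM le_rfl
    (le_add_of_nonneg_right N.cast_nonneg) hA hε.le (min_le_left _ _) (min_le_right _ _) hE hE₀
  choose! L S hS hSL using hkey
  obtain ⟨hfin, hcard⟩ := hN CZ hCZ E hE₀.nonempty
  refine ⟨_, L, S, Set.sep_subset CZ _, ⟨hfin, ?_⟩, fun Q hQ => ?_, fun Q hQ Q' hQ' hQQ' => ?_⟩
  · calc _ ≤ (N * E.card : ℝ) := by exact_mod_cast hcard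
      _ ≤ _ := by gcongr; exact le_add_of_nonneg_left (by positivity)
  · obtain ⟨hL, hmem, hfirst, hkeystone, hadjacent, hside⟩ := hS Q hQ
    exact ⟨hL, hmem, hfirst, hkeystone, hadjacent, hside⟩
  · have hT (Q) (hQ : Q ∈ CZ \ {Q ∈ CZ | ¬IsTight hCZ.scale E A ε Q}) :
        IsTight hCZ.scale E A ε Q := not_not.1 fun h => hQ.2 ⟨hQ.1, h⟩
    rw [hSL Q hQ.1 (hT Q hQ), hSL Q' hQ'.1 (hT Q' hQ'),
      hCZ.clusterTarget_eq_of_inter_nonempty hcG.le le_rfl (min_le_left _ _)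
        (fun Q hQ => (hE Q hQ).nonempty) hQ.1 hQ'.1 (hT Q hQ) (hT Q' hQ') hQQ']
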